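/- **Theorem 3.1.** Let $M$ be a smooth (Hausdorff) manifold of dimension $2n+1$ with a Riemannian metric $g$, let $\nabla$ be the Levi-Civita connection of $g$, and let $f,Q$ be smooth $(1,1)$-tensor fields with $Q$ nonsingular at every point, $\xi$ a smooth vector field and $\eta$ a smooth 1-form on $M$. Suppose that $(f,Q,\xi,\eta,g)$ is a weak almost-contact metric structure, that is, $$f^2=-Q+\eta\otimes\xi,\qquad \eta(\xi)=1,\qquad g(fX,fY)=g(X,QY)-\eta(X)\,\eta(Y),\qquad \eta(X)=g(\xi,X),$$ and that it is weak quasi-contact metric, that is, $$(\nabla_Xf)Y+(\nabla_{fX}f)fY=2\,g(X,Y)\,\xi-\eta(Y)\big(X+hX+\eta(X)\,\xi\big)$$ for all smooth vector fields $X,Y$ on $M$, where $hX=\tfrac12(\mathcal L_\xi f)X=\tfrac12\big([\xi,fX]-f[\xi,X]\big)$. Suppose moreover that $\nabla_X\xi=-fX$ for all $X$. Then $Q=\mathrm{id}_{TM}$ and $M(f,\xi,\eta,g)$ is a K-contact manifold, that is: it is almost-contact metric, $$f^2=-\mathrm{id}+\eta\otimes\xi,\qquad \eta(\xi)=1,\qquad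 g(fX,fY)=g(X,Y)-\eta(X)\,\eta(Y),\qquad \eta(X)=g(\xi,X);$$ it is contact metric, $d\eta(X,Y)=g(X,fY)$, where $2\,d\eta(X,Y)=X(\eta(Y))-Y(\eta(X))-\eta([X,Y])$; and $\xi$ is a Killing vector field, $\mathcal L_\xi g=0$. -/

import Mathlib

open Bundle Manifold ContDiff VectorField FiberBundle

noncomputable section

namespace WeakContact

/-! ### The Levi-Civita connection of a Riemannian metric `g` on a smooth manifold `M` -/

section LeviCivita

variable {E : Type*} [NormedAddCommGroup E] [NormedSpace ℝ E]
  {H : Type*} [TopologicalSpace H] {I : ModelWithCorners ℝ E H}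
  {M : Type*} [TopologicalSpace M] [ChartedSpace H M] [IsManifold I ∞ M]
  (g : ContMDiffRiemannianMetric I ∞ E (fun x : M ↦ TangentSpace I x))

theorem mdifferentiableAt_metric {X Y : Π x : M, TangentSpace I x} {x : M}
    (hX : MDiffAt (T% X) x) (hY : MDiffAt (T% Y) x) :
    MDiffAt (fun y ↦ g.inner y (X y) (Y y)) x := by
  have : MDifferentiableAt I (I.prod 𝓘(ℝ))
      (fun m ↦ TotalSpace.mk' ℝ (E := Bundle.Trivial M ℝ) m (g.inner m (X m) (Y m))) x := by
    apply MDifferentiableAt.clm_bundle_apply₂ (F₁ := E) (F₂ := E)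
    · exact g.contMDiff.mdifferentiableAt (by simp)
    · exact hX
    · exact hY
  simp only [mdifferentiableAt_totalSpace] at this
  exact this.2

/-- The right-hand side of the Koszul formula, which is `g(∇_X Y, Z)` at the point `x`:
half of `X g(Y,Z) + Y g(Z,X) - Z g(X,Y) + g([X,Y],Z) - g([Y,Z],X) + g([Z,X],Y)`. -/
def koszul (X Y Z : Π x : M, TangentSpace I x) (x : M) : ℝ :=
  (1 / 2 : ℝ) *
    (mvfderiv I (fun y ↦ g.inner y (Y y) (Z y)) x (X x)
      + mvfderiv I (fun y ↦ g.inner y (Z y) (X y)) x (Y x)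
      - mvfderiv I (fun y ↦ g.inner y (X y) (Y y)) x (Z x)
      + g.inner x (mlieBracket I X Y x) (Z x)
      - g.inner x (mlieBracket I Y Z x) (X x)
      + g.inner x (mlieBracket I Z X x) (Y x))

theorem koszul_add_swap {X Y Z : Π x : M, TangentSpace I x} {x : M} :
    koszul g X Y Z x + koszul g X Z Y x =
      mvfderiv I (fun y ↦ g.inner y (Y y) (Z y)) x (X x) := by
  have e (A B : Π x : M, TangentSpace I x) :
      (fun y ↦ g.inner y (A y) (B y)) = fun y ↦ g.inner y (B y) (A y) :=
    funext fun y ↦ g.symm y _ _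
  simp only [koszul]
  rw [mlieBracket_swap_apply (V := Z) (W := Y), mlieBracket_swap_apply (V := X) (W := Z),
    mlieBracket_swap_apply (V := Y) (W := X), e Z Y, e Z X, e X Y]
  simp only [map_neg, neg_apply]
  ring

theorem koszul_sub_swap {X Y Z : Π x : M, TangentSpace I x} {x : M} :
    koszul g X Y Z x - koszul g Y X Z x = g.inner x (mlieBracket I X Y x) (Z x) := by
  have e (A B : Π x : M, TangentSpace I x) :
      (fun y ↦ g.inner y (A y) (B y)) = fun y ↦ g.inner y (B y) (A y) :=
    funext fun y ↦ g.symm y _ _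
  simp only [koszul]
  rw [mlieBracket_swap_apply (V := Z) (W := Y), mlieBracket_swap_apply (V := X) (W := Z),
    mlieBracket_swap_apply (V := Y) (W := X), e Z Y, e Z X, e X Y]
  simp only [map_neg, neg_apply]
  ring

theorem inner_injective (x : M) : Function.Injective (g.inner x) := by
  rw [injective_iff_map_eq_zero]
  intro v hv
  by_contra h
  exact (g.pos x v h).ne' (by rw [hv]; rfl)

theorem clm_ext_inner {x : M} {A B : TangentSpace I x →L[ℝ] TangentSpace I x}
    (h : ∀ X Z : Π x : M, TangentSpace I x, MDiffAt (T% X) x → MDiffAt (T% Z) x →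
      g.inner x (A (X x)) (Z x) = g.inner x (B (X x)) (Z x)) : A = B := by
  ext1 v
  apply inner_injective g x
  ext1 w
  simpa using h (extend E v) (extend E w) (mdifferentiableAt_extend ..)
    (mdifferentiableAt_extend ..)

variable [FiniteDimensional ℝ E]

theorem koszul_tensorial_left {Y Z : Π x : M, TangentSpace I x} {x : M}
    (hY : MDiffAt (T% Y) x) (hZ : MDiffAt (T% Z) x) :
    TensorialAt I E (fun X ↦ koszul g X Y Z x) x where
  smul {f X} hf hX := by
    have : CompleteSpace E := FiniteDimensional.complete ℝ E
    have h1 := mdifferentiableAt_metric g hZ hX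
    have h2 := mdifferentiableAt_metric g hX hY
    simp only [koszul, Pi.smul_apply', map_smul, smul_apply, smul_eq_mul,
      mvfderiv_fun_mul hf h1, mvfderiv_fun_mul hf h2, mlieBracket_smul_left hf hX,
      mlieBracket_smul_right hf hX, add_apply, map_add]
    rw [g.symm x (Z x) (X x)]
    ring
  add {X X'} hX hX' := by
    have : CompleteSpace E := FiniteDimensional.complete ℝ E
    simp only [koszul, Pi.add_apply, map_add, add_apply,
      mvfderiv_fun_add (mdifferentiableAt_metric g hZ hX) (mdifferentiableAt_metric g hZ hX'),
      mvfderiv_fun_add (mdifferentiableAt_metric g hX hY) (mdifferentiableAt_metric g hX' hY),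
      mlieBracket_add_left hX hX', mlieBracket_add_right hX hX']
    ring

theorem koszul_tensorial_right {X Y : Π x : M, TangentSpace I x} {x : M}
    (hX : MDiffAt (T% X) x) (hY : MDiffAt (T% Y) x) :
    TensorialAt I E (fun Z ↦ koszul g X Y Z x) x where
  smul {f Z} hf hZ := by
    have : CompleteSpace E := FiniteDimensional.complete ℝ E
    have h1 := mdifferentiableAt_metric g hY hZ
    have h2 := mdifferentiableAt_metric g hZ hX
    simp only [koszul, Pi.smul_apply', map_smul, smul_apply, smul_eq_mul,
      mvfderiv_fun_mul hf h1, mvfderiv_fun_mul hf h2, mlieBracket_smul_left hf hZ,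
      mlieBracket_smul_right hf hZ, add_apply, map_add]
    rw [g.symm x (Z x) (X x), g.symm x (Z x) (Y x)]
    ring
  add {Z Z'} hZ hZ' := by
    have : CompleteSpace E := FiniteDimensional.complete ℝ E
    simp only [koszul, Pi.add_apply, map_add, add_apply,
      mvfderiv_fun_add (mdifferentiableAt_metric g hY hZ) (mdifferentiableAt_metric g hY hZ'),
      mvfderiv_fun_add (mdifferentiableAt_metric g hZ hX) (mdifferentiableAt_metric g hZ' hX),
      mlieBracket_add_left hZ hZ', mlieBracket_add_right hZ hZ']
    ring

theorem koszul_add_middle {X Y Y' Z : Π x : M, TangentSpace I x} {x : M}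
    (hX : MDiffAt (T% X) x) (hY : MDiffAt (T% Y) x) (hY' : MDiffAt (T% Y') x)
    (hZ : MDiffAt (T% Z) x) :
    koszul g X (Y + Y') Z x = koszul g X Y Z x + koszul g X Y' Z x := by
  have : CompleteSpace E := FiniteDimensional.complete ℝ E
  simp only [koszul, Pi.add_apply, map_add, add_apply,
    mvfderiv_fun_add (mdifferentiableAt_metric g hY hZ) (mdifferentiableAt_metric g hY' hZ),
    mvfderiv_fun_add (mdifferentiableAt_metric g hX hY) (mdifferentiableAt_metric g hX hY'),
    mlieBracket_add_left hY hY', mlieBracket_add_right hY hY']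
  ring

theorem koszul_smul_middle {X Y Z : Π x : M, TangentSpace I x} {x : M} {f : M → ℝ}
    (hf : MDiffAt f x)
    (hX : MDiffAt (T% X) x) (hY : MDiffAt (T% Y) x) (hZ : MDiffAt (T% Z) x) :
    koszul g X (f • Y) Z x =
      f x * koszul g X Y Z x + mvfderiv I f x (X x) * g.inner x (Y x) (Z x) := by
  have : CompleteSpace E := FiniteDimensional.complete ℝ E
  have h1 := mdifferentiableAt_metric g hY hZ
  have h2 := mdifferentiableAt_metric g hX hY
  simp only [koszul, Pi.smul_apply', map_smul, smul_apply, smul_eq_mul,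
    mvfderiv_fun_mul hf h1, mvfderiv_fun_mul hf h2, mlieBracket_smul_left hf hY,
    mlieBracket_smul_right hf hY, add_apply, map_add]
  rw [g.symm x (Y x) (X x)]
  ring

instance instFiniteDimensionalTangent (x : M) : FiniteDimensional ℝ (TangentSpace I x) :=
  inferInstanceAs (FiniteDimensional ℝ E)

instance instT2SpaceTangent (x : M) : T2Space (TangentSpace I x) :=
  inferInstanceAs (T2Space E)

/-- The musical isomorphism `v ↦ g(v, ·)` from `T_x M` onto its dual. -/
def flat (x : M) : TangentSpace I x ≃ₗ[ℝ] (TangentSpace I x →L[ℝ] ℝ) :=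
  LinearEquiv.ofInjectiveOfFinrankEq (g.inner x : TangentSpace I x →ₗ[ℝ] _)
    (inner_injective g x) (by
      rw [← (LinearMap.toContinuousLinearMap (𝕜 := ℝ) (E := TangentSpace I x)
        (F' := ℝ)).finrank_eq]
      exact Subspace.dual_finrank_eq.symm)

theorem inner_flat_symm (x : M) (l : TangentSpace I x →L[ℝ] ℝ) :
    g.inner x ((flat g x).symm l) = l :=
  (flat g x).apply_symm_apply l

open Classical in
/-- The Levi-Civita connection as an operator on vector fields, built from the Koszul formula:
`leviCivitaFun g Y x v` is `∇_v Y`, the vector at `x` such that `g(∇_v Y, w)` is the Koszul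
expression of any fields extending `v`, `Y`, `w`. The value `0` is used where `Y` is not
differentiable. -/
def leviCivitaFun (Y : Π x : M, TangentSpace I x) (x : M) :
    TangentSpace I x →L[ℝ] TangentSpace I x :=
  if hY : MDiffAt (T% Y) x then
    (LinearMap.toContinuousLinearMap (𝕜 := ℝ) (E := TangentSpace I x) (F' := TangentSpace I x))
      ((flat g x).symm.toLinearMap ∘ₗ
      (TensorialAt.mkHom₂ (I := I) (F := E) (F' := E) (fun X Z ↦ koszul g X Y Z x) x
        (fun _ hZ ↦ koszul_tensorial_left g hY hZ)
        (fun _ hX ↦ koszul_tensorial_right g hX hY) :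
          TangentSpace I x →ₗ[ℝ] (TangentSpace I x →L[ℝ] ℝ)))
  else 0

theorem inner_leviCivitaFun {X Y Z : Π x : M, TangentSpace I x} {x : M}
    (hX : MDiffAt (T% X) x) (hY : MDiffAt (T% Y) x) (hZ : MDiffAt (T% Z) x) :
    g.inner x (leviCivitaFun g Y x (X x)) (Z x) = koszul g X Y Z x := by
  rw [leviCivitaFun, dif_pos hY]
  change g.inner x ((flat g x).symm _) (Z x) = _
  rw [inner_flat_symm]
  exact TensorialAt.mkHom₂_apply _ _ hX hZ

/-- The Levi-Civita connection of `g`, as a covariant derivative on the tangent bundle;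
`leviCivita g Y x v` is `∇_v Y` at `x`. -/
def leviCivita : CovariantDerivative I E (fun x : M ↦ TangentSpace I x) where
  toFun := leviCivitaFun g
  isCovariantDerivativeOnUniv :=
    { add := by
        intro Y Y' x hY hY' _
        refine clm_ext_inner g fun X Z hX hZ ↦ ?_
        have hs : MDiffAt (T% (Y + Y')) x := mdifferentiableAt_add_section hY hY'
        rw [inner_leviCivitaFun g hX hs hZ, koszul_add_middle g hX hY hY' hZ]
        simp [inner_leviCivitaFun g hX hY hZ, inner_leviCivitaFun g hX hY' hZ]
      leibniz := by
        intro Y f x hY hf _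
        refine clm_ext_inner g fun X Z hX hZ ↦ ?_
        have hs : MDiffAt (T% (f • Y)) x := hf.smul_section hY
        rw [inner_leviCivitaFun g hX hs hZ, koszul_smul_middle g hf hX hY hZ]
        simp [inner_leviCivitaFun g hX hY hZ] }

/-- `∇` is torsion-free. -/
theorem leviCivita_torsion {X Y : Π x : M, TangentSpace I x} {x : M}
    (hX : MDiffAt (T% X) x) (hY : MDiffAt (T% Y) x) :
    leviCivita g Y x (X x) - leviCivita g X x (Y x) = mlieBracket I X Y x := by
  apply inner_injective g x
  ext1 w
  have hw : MDiffAt (T% (extend E w : Π x : M, TangentSpace I x)) x :=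
    mdifferentiableAt_extend ..
  have h1 := inner_leviCivitaFun g hX hY hw
  have h2 := inner_leviCivitaFun g hY hX hw
  have h3 := koszul_sub_swap g (X := X) (Y := Y) (Z := extend E w) (x := x)
  rw [← h1, ← h2] at h3
  simpa [leviCivita] using h3

/-- `∇` is compatible with the metric. -/
theorem leviCivita_metric {X Y Z : Π x : M, TangentSpace I x} {x : M}
    (hX : MDiffAt (T% X) x) (hY : MDiffAt (T% Y) x) (hZ : MDiffAt (T% Z) x) :
    mvfderiv I (fun y ↦ g.inner y (Y y) (Z y)) x (X x) =
      g.inner x (leviCivita g Y x (X x)) (Z x) + g.inner x (Y x) (leviCivita g Z x (X x)) := by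
  have h1 := inner_leviCivitaFun g hX hY hZ
  have h2 := inner_leviCivitaFun g hX hZ hY
  rw [← koszul_add_swap g, ← h1, ← h2, g.symm x (Y x)]
  rfl

end LeviCivita

/-! ### Smooth vector fields, 1-forms, (1,1)-tensors, and the operators on them -/

section Structures

variable {E : Type*} [NormedAddCommGroup E] [NormedSpace ℝ E]
  {H : Type*} [TopologicalSpace H] (I : ModelWithCorners ℝ E H)
  (M : Type*) [TopologicalSpace M] [ChartedSpace H M] [IsManifold I ∞ M]

/-- Smooth vector fields on `M`. -/
abbrev VecField := ContMDiffSection I E ∞ (fun x : M ↦ TangentSpace I x)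

/-- Smooth 1-forms on `M`. -/
abbrev OneForm := ContMDiffSection I (E →L[ℝ] ℝ) ∞ (fun x : M ↦ TangentSpace I x →L[ℝ] ℝ)

/-- Smooth (1,1)-tensors on `M`, that is, smooth fields of endomorphisms of the tangent spaces. -/
abbrev EndField := ContMDiffSection I (E →L[ℝ] E) ∞
  (fun x : M ↦ TangentSpace I x →L[ℝ] TangentSpace I x)

variable {I M}

/-- The vector field `f X`. -/
def EndField.app (f : EndField I M) (X : Π x : M, TangentSpace I x) :
    Π x : M, TangentSpace I x :=
  fun x ↦ f x (X x)

/-- The tensor `h = (1/2) £_ξ f`, that is, `h X = (1/2) ([ξ, f X] - f [ξ, X])`. -/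
def hTensor (f : EndField I M) (ξ X : VecField I M) (x : M) : TangentSpace I x :=
  (1 / 2 : ℝ) • (mlieBracket I ξ (f.app X) x - f x (mlieBracket I ξ X x))

/-- The exterior derivative of a 1-form, with the normalization
`2 dη(X,Y) = X(η(Y)) - Y(η(X)) - η([X,Y])`. -/
def dOneForm (η : OneForm I M) (X Y : VecField I M) (x : M) : ℝ :=
  (1 / 2 : ℝ) * (mvfderiv I (fun y ↦ η y (Y y)) x (X x)
    - mvfderiv I (fun y ↦ η y (X y)) x (Y x) - η x (mlieBracket I X Y x))

variable (g : ContMDiffRiemannianMetric I ∞ E (fun x : M ↦ TangentSpace I x))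

/-- `ξ` is a Killing vector field: `(£_ξ g)(X,Y) = ξ(g(X,Y)) - g([ξ,X],Y) - g(X,[ξ,Y]) = 0`. -/
def IsKilling (ξ : VecField I M) : Prop :=
  ∀ (X Y : VecField I M) (x : M),
    mvfderiv I (fun y ↦ g.inner y (X y) (Y y)) x (ξ x)
      - g.inner x (mlieBracket I ξ X x) (Y x) - g.inner x (X x) (mlieBracket I ξ Y x) = 0

/-- `(f, Q, ξ, η, g)` is a weak almost-contact metric structure. -/
structure IsWeakAlmostContactMetric (f Q : EndField I M) (ξ : VecField I M) (η : OneForm I M) :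
    Prop where
  nonsingular : ∀ x : M, Function.Bijective (Q x)
  f_sq : ∀ (x : M) (v : TangentSpace I x), f x (f x v) = -Q x v + η x v • ξ x
  eta_xi : ∀ x : M, η x (ξ x) = 1
  metric : ∀ (x : M) (v w : TangentSpace I x),
    g.inner x (f x v) (f x w) = g.inner x v (Q x w) - η x v * η x w
  eta_eq : ∀ (x : M) (v : TangentSpace I x), η x v = g.inner x (ξ x) v

/-- `(f, ξ, η, g)` is an almost-contact metric structure. -/
structure IsAlmostContactMetric (f : EndField I M) (ξ : VecField I M) (η : OneForm I M) :
    Prop where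
  f_sq : ∀ (x : M) (v : TangentSpace I x), f x (f x v) = -v + η x v • ξ x
  eta_xi : ∀ x : M, η x (ξ x) = 1
  metric : ∀ (x : M) (v w : TangentSpace I x),
    g.inner x (f x v) (f x w) = g.inner x v w - η x v * η x w
  eta_eq : ∀ (x : M) (v : TangentSpace I x), η x v = g.inner x (ξ x) v

/-- `(f, ξ, η, g)` is a contact metric structure: an almost-contact metric structure with
`dη = Φ`, where `Φ(X,Y) = g(X, f Y)`. -/
structure IsContactMetric (f : EndField I M) (ξ : VecField I M) (η : OneForm I M) : Prop
    extends IsAlmostContactMetric g f ξ η where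
  d_eta : ∀ (X Y : VecField I M) (x : M), dOneForm η X Y x = g.inner x (X x) (f x (Y x))

/-- `(f, ξ, η, g)` is a K-contact structure: a contact metric structure whose `ξ` is Killing. -/
structure IsKContact (f : EndField I M) (ξ : VecField I M) (η : OneForm I M) : Prop
    extends IsContactMetric g f ξ η where
  killing : IsKilling g ξ

variable [FiniteDimensional ℝ E]

/-- `(∇_X f) Y = ∇_X (f Y) - f (∇_X Y)` for the Levi-Civita connection of `g`. -/
def covDerivEnd (f : EndField I M) (X Y : Π x : M, TangentSpace I x) (x : M) :
    TangentSpace I x :=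
  leviCivita g (f.app Y) x (X x) - f x (leviCivita g Y x (X x))

/-- `(f, Q, ξ, η, g)` is a weak quasi-contact metric structure: a weak almost-contact metric
structure such that
`(∇_X f) Y + (∇_{f X} f) (f Y) = 2 g(X,Y) ξ - η(Y) (X + h X + η(X) ξ)`. -/
structure IsWeakQuasiContactMetric (f Q : EndField I M) (ξ : VecField I M) (η : OneForm I M) :
    Prop extends IsWeakAlmostContactMetric g f Q ξ η where
  quasi : ∀ (X Y : VecField I M) (x : M),
    covDerivEnd g f X Y x + covDerivEnd g f (f.app X) (f.app Y) x =
      (2 * g.inner x (X x) (Y x)) • ξ x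
        - η x (Y x) • (X x + hTensor f ξ X x + η x (X x) • ξ x)

end Structures

end WeakContact

end

namespace WeakContact

section Sections

variable {E : Type*} [NormedAddCommGroup E] [NormedSpace ℝ E]
  {H : Type*} [TopologicalSpace H] {I : ModelWithCorners ℝ E H}
  {M : Type*} [TopologicalSpace M] [ChartedSpace H M] [IsManifold I ∞ M]

/-- On a finite-dimensional Hausdorff manifold every tangent vector is the value of a globally
defined smooth vector field. -/
theorem exists_vecField_apply_eq [FiniteDimensional ℝ E] [T2Space M] {x : M}
    (v : TangentSpace I x) : ∃ X : VecField I M, X x = v := by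
  obtain ⟨s, hs, hsmooth⟩ := exists_contMDiffOn_extend (k := ∞) I E v
  obtain ⟨ψ, -, hψ⟩ :=
    (SmoothBumpFunction.nhds_basis_tsupport (I := I) x).mem_iff.1 (interior_mem_nhds.2 hs)
  refine ⟨⟨(ψ : M → ℝ) • (extend E v : Π y : M, TangentSpace I y),
    ContMDiffOn.smul_section_of_tsupport ψ.contMDiff.contMDiffOn isOpen_interior hψ
      (hsmooth.mono interior_subset)⟩, ?_⟩
  change ψ x • extend E v x = v
  simp

theorem EndField.mdifferentiableAt_app (f : EndField I M) {X : Π x : M, TangentSpace I x} {x : M}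
    (hX : MDiffAt (T% X) x) : MDiffAt (T% (f.app X)) x :=
  MDifferentiableAt.clm_bundle_apply (F₁ := E) (F₂ := E) f.mdifferentiableAt hX

end Sections

section WeakStructure

variable {E : Type*} [NormedAddCommGroup E] [NormedSpace ℝ E] [FiniteDimensional ℝ E]
  {H : Type*} [TopologicalSpace H] {I : ModelWithCorners ℝ E H}
  {M : Type*} [TopologicalSpace M] [ChartedSpace H M] [IsManifold I ∞ M]
  {g : ContMDiffRiemannianMetric I ∞ E (fun x : M ↦ TangentSpace I x)}
  {f Q : EndField I M} {ξ : VecField I M} {η : OneForm I M}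

theorem inner_leviCivita_self_eq_zero (hunit : ∀ x, g.inner x (ξ x) (ξ x) = 1) (x : M)
    (v : TangentSpace I x) : g.inner x (leviCivita g ξ x v) (ξ x) = 0 := by
  have h := leviCivita_metric g (X := extend E v) (Y := ξ) (Z := ξ) (x := x)
    (mdifferentiableAt_extend ..) ξ.mdifferentiableAt ξ.mdifferentiableAt
  have hc : (fun y ↦ g.inner y (ξ y) (ξ y)) = fun _ ↦ (1 : ℝ) := funext hunit
  rw [hc, g.symm x (ξ x)] at h
  simp only [mvfderiv_const, extend_apply_self, zero_apply] at h
  linarith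

theorem hTensor_eq (hnabla : ∀ x v, leviCivita g ξ x v = -f x v) (X : VecField I M) (x : M) :
    hTensor f ξ X x = (1 / 2 : ℝ) • covDerivEnd g f ξ X x := by
  rw [hTensor, covDerivEnd,
    ← leviCivita_torsion g ξ.mdifferentiableAt (f.mdifferentiableAt_app X.mdifferentiableAt),
    ← leviCivita_torsion g ξ.mdifferentiableAt X.mdifferentiableAt, hnabla, hnabla]
  congr 1
  simp [EndField.app]

namespace IsWeakAlmostContactMetric

variable (h : IsWeakAlmostContactMetric g f Q ξ η)
include h

omit [FiniteDimensional ℝ E] in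
theorem inner_xi_self (x : M) : g.inner x (ξ x) (ξ x) = 1 := by
  rw [← h.eta_eq, h.eta_xi]

theorem eta_f (hnabla : ∀ x v, leviCivita g ξ x v = -f x v) (x : M) (v : TangentSpace I x) :
    η x (f x v) = 0 := by
  have := inner_leviCivita_self_eq_zero h.inner_xi_self x v
  rw [hnabla, map_neg, neg_apply, neg_eq_zero] at this
  rw [h.eta_eq, g.symm, this]

section

variable (hηf : ∀ x v, η x (f x v) = 0)
include hηf

omit [FiniteDimensional ℝ E]

theorem eta_Q (x : M) (v : TangentSpace I x) : η x (Q x v) = η x v := by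
  have := hηf x (f x v)
  rw [h.f_sq, map_add, map_neg, map_smul, h.eta_xi, smul_eq_mul] at this
  linarith

theorem f_xi (x : M) : f x (ξ x) = 0 := by
  by_contra hne
  have hpos := g.pos x _ hne
  rw [h.metric, ← h.eta_eq, h.eta_Q hηf, h.eta_xi] at hpos
  norm_num at hpos

theorem inner_f_left (x : M) (v w : TangentSpace I x) :
    g.inner x (f x v) w = -g.inner x v (f x w) := by
  have key (v w : TangentSpace I x) :
      g.inner x (f x v) (f x w) = -g.inner x v (f x (f x w)) := by
    rw [h.metric, h.f_sq, map_add, map_neg, map_smul, smul_eq_mul, g.symm x v (ξ x), ← h.eta_eq]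
    ring
  obtain ⟨u, hu⟩ := (h.nonsingular x).2 (w - η x w • ξ x)
  have hηu : η x u = 0 := by
    rw [← h.eta_Q hηf, hu, map_sub, map_smul, h.eta_xi]
    simp
  have hw : w = η x w • ξ x - f x (f x u) := by
    rw [h.f_sq, hu, hηu]
    simp
  have hfw : f x w = -f x (f x (f x u)) := by
    conv_lhs => rw [hw]
    rw [map_sub, map_smul, h.f_xi hηf]
    simp
  have h1 : g.inner x (f x v) w = -g.inner x (f x v) (f x (f x u)) := by
    conv_lhs => rw [hw]
    rw [map_sub, map_smul, g.symm x (f x v) (ξ x), ← h.eta_eq, hηf]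
    simp
  rw [h1, key, hfw, map_neg]

theorem app_xi : f.app ξ = 0 := funext fun x ↦ h.f_xi hηf x

end

variable (hnabla : ∀ x v, leviCivita g ξ x v = -f x v)
include hnabla

theorem covDerivEnd_xi (X : Π x : M, TangentSpace I x) (x : M) :
    covDerivEnd g f X ξ x = f x (f x (X x)) := by
  rw [covDerivEnd, hnabla, h.app_xi (h.eta_f hnabla), CovariantDerivative.zero]
  simp

/-- A vector field with `∇ξ = -f` is Killing. -/
theorem isKilling : IsKilling g ξ := by
  intro X Y x
  rw [leviCivita_metric g ξ.mdifferentiableAt X.mdifferentiableAt Y.mdifferentiableAt,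
    ← leviCivita_torsion g ξ.mdifferentiableAt X.mdifferentiableAt,
    ← leviCivita_torsion g ξ.mdifferentiableAt Y.mdifferentiableAt, hnabla, hnabla]
  simp only [map_sub, map_neg, sub_apply, neg_apply, h.inner_f_left (h.eta_f hnabla)]
  ring

theorem dOneForm_eq (X Y : VecField I M) (x : M) :
    dOneForm η X Y x = g.inner x (X x) (f x (Y x)) := by
  have e (Z : VecField I M) : (fun y ↦ η y (Z y)) = fun y ↦ g.inner y (ξ y) (Z y) :=
    funext fun y ↦ h.eta_eq y _
  rw [dOneForm, e X, e Y,
    leviCivita_metric g X.mdifferentiableAt ξ.mdifferentiableAt Y.mdifferentiableAt,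
    leviCivita_metric g Y.mdifferentiableAt ξ.mdifferentiableAt X.mdifferentiableAt,
    ← leviCivita_torsion g X.mdifferentiableAt Y.mdifferentiableAt, h.eta_eq, hnabla, hnabla]
  simp only [map_sub, map_neg, neg_apply, h.inner_f_left (h.eta_f hnabla)]
  rw [g.symm x (Y x), h.inner_f_left (h.eta_f hnabla)]
  ring

end IsWeakAlmostContactMetric

namespace IsWeakQuasiContactMetric

variable (h : IsWeakQuasiContactMetric g f Q ξ η)
  (hnabla : ∀ x v, leviCivita g ξ x v = -f x v)
include h hnabla

theorem hTensor_eq_zero (X : VecField I M) (x : M) : hTensor f ξ X x = 0 := by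
  have hfξ := h.f_xi (h.eta_f hnabla) x
  have hξ : hTensor f ξ ξ x = 0 := by
    rw [hTensor_eq hnabla, h.covDerivEnd_xi hnabla, hfξ, map_zero, smul_zero]
  have hq := h.quasi ξ X x
  have h0 : covDerivEnd g f (f.app ξ) (f.app X) x = 0 := by
    simp [covDerivEnd, EndField.app, hfξ]
  rw [h0, hξ, ← h.eta_eq, h.eta_xi] at hq
  rw [hTensor_eq hnabla, ← add_zero (covDerivEnd g f ξ X x), hq]
  module

theorem Q_eq_id [T2Space M] (x : M) (v : TangentSpace I x) : Q x v = v := by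
  obtain ⟨X, rfl⟩ := exists_vecField_apply_eq v
  have hq := h.quasi X ξ x
  have h0 : covDerivEnd g f (f.app X) (f.app ξ) x = 0 := by
    rw [covDerivEnd, h.app_xi (h.eta_f hnabla)]
    have : f.app (0 : Π y : M, TangentSpace I y) = 0 := funext fun y ↦ map_zero (f y)
    rw [this, CovariantDerivative.zero]
    simp
  rw [h0, h.covDerivEnd_xi hnabla, h.f_sq, h.hTensor_eq_zero hnabla, h.eta_xi,
    g.symm x (X x), ← h.eta_eq] at hq
  have e1 : Q x (X x) = η x (X x) • ξ x - (-Q x (X x) + η x (X x) • ξ x + 0) := by module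
  rw [e1, hq]
  module

theorem isKContact [T2Space M] : IsKContact g f ξ η where
  f_sq x v := by rw [h.f_sq, h.Q_eq_id hnabla]
  eta_xi := h.eta_xi
  metric x v w := by rw [h.metric, h.Q_eq_id hnabla]
  eta_eq := h.eta_eq
  d_eta := h.dOneForm_eq hnabla
  killing := h.isKilling hnabla

end IsWeakQuasiContactMetric

end WeakStructure

end WeakContact

theorem theorem3p1 (n : ℕ) {M : Type*} [TopologicalSpace M] [T2Space M]
    [ChartedSpace (EuclideanSpace ℝ (Fin (2 * n + 1))) M]
    [IsManifold (𝓡 (2 * n + 1)) ∞ M]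
    (g : ContMDiffRiemannianMetric (𝓡 (2 * n + 1)) ∞ (EuclideanSpace ℝ (Fin (2 * n + 1)))
      (fun x : M ↦ TangentSpace (𝓡 (2 * n + 1)) x))
    (f Q : WeakContact.EndField (𝓡 (2 * n + 1)) M)
    (ξ : WeakContact.VecField (𝓡 (2 * n + 1)) M)
    (η : WeakContact.OneForm (𝓡 (2 * n + 1)) M)
    (hqcm : WeakContact.IsWeakQuasiContactMetric g f Q ξ η)
    (hnabla : ∀ (x : M) (v : TangentSpace (𝓡 (2 * n + 1)) x),
      WeakContact.leviCivita g ξ x v = -f x v) :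
    (∀ (x : M) (v : TangentSpace (𝓡 (2 * n + 1)) x), Q x v = v) ∧
      WeakContact.IsKContact g f ξ η :=
  ⟨hqcm.Q_eq_id hnabla, hqcm.isKContact hnabla⟩
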